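/- **Model.** Let $N\ge 1$, let $\Omega$ be a finite set and $f:\Omega\to\mathbb N$. For each $\epsilon\in(0,1)$ and each pair $(i,j)\in\{1,\dots,N\}^2$ let $P^{(\epsilon)}_{ij}$ be a transition matrix on $\Omega$, and let $\mathbf X^t=(X^t_{ij})$ be the Markov chain on $\Omega^{N^2}$ whose coordinates are independent chains with these transition matrices; assume that this chain is irreducible and aperiodic. An $N\times N$ input-queued switch with queue lengths $Q^t_{ij}\in\mathbb N$ evolves by $$Q^{t+1}_{ij}=\big[Q^t_{ij}+A^t_{ij}-S^t_{ij}\big]^+,\qquad A^t_{ij}=f(X^t_{ij}),$$ where $\mathbf S^t$ is chosen by MaxWeight: given $\mathbf Q^t$, it is uniformly distributed on the set of permutation matrices $\mathbf s$ that maximize $\langle \mathbf Q^t,\mathbf s\rangle=\sum_{ij}Q^t_{ij}s_{ij}$ among all $0/1$ matrices with row and column sums at most one, independently of the transition of $\mathbf X^t$. Thus $(\mathbf Q^t,\mathbf X^t)$ is a Markov chain on $\mathbb N^{N^2}\times\Omega^{N^2}$. **Heavy traffic.** Let $\mathcal F$ be the set of nonnegative $N\times N$ matrices with all row and column sums equal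 to $1$, and let $\mathbf v\in\mathcal F$ satisfy $v_{\min}=\min_{ij}v_{ij}>0$. Assume that for every $\epsilon\in(0,1)$ the stationary mean of $f(X_{ij})$ is $\lambda^{(\epsilon)}_{ij}=(1-\epsilon)v_{ij}$ for all $i,j$. Assume also uniform geometric mixing: there are constants $\alpha_{\max}<1$ and $C_{\max}<\infty$ and numbers $0<\alpha^{(\epsilon)}_{ij}\le\alpha_{\max}$, $0<C^{(\epsilon)}_{ij}\le C_{\max}$ such that, with $L=\max_\Omega f$, for every $\epsilon\in(0,1)$, all $i,j$, every initial law of $X_{ij}^0$ and every $m\ge1$, $$\big|E[f(X^m_{ij})]-\lambda^{(\epsilon)}_{ij}\big|\le 2\,L\,C^{(\epsilon)}_{ij}\big(\alpha^{(\epsilon)}_{ij}\big)^m .$$ **Cones.** Let $\mathbf e^{(i)}$ (resp. $\tilde{\mathbf e}^{(j)}$) be the matrix with ones in row $i$ (resp. column $j$) and zeros elsewhere, let $$\mathcal K=\Big\{\sum_i w_i\mathbf e^{(i)}+\sum_j\tilde w_j\tilde{\mathbf e}^{(j)}:\ w_i,\tilde w_j\ge0\Big\}$$ (the normal cone of the face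 $\mathcal F$ of the capacity region), and let $\mathcal L$ be the linear span of $\mathcal K$. For $\mathcal W\in\{\mathcal K,\mathcal L\}$ let $\mathbf x_{\perp\mathcal W}=\mathbf x-\mathbf x_{\parallel\mathcal W}$, where $\mathbf x_{\parallel\mathcal W}$ is the point of $\mathcal W$ nearest to $\mathbf x$ in the Euclidean norm of $\mathbb R^{N^2}$. **Proposition (state space collapse).** There is a constant $K^{\star\star}$, not depending on $\epsilon$, such that for every $\epsilon\in(0,1)$ with $\epsilon<v_{\min}/(2\|\mathbf v\|)$ the chain $(\mathbf Q^t,\mathbf X^t)$ has a stationary distribution, and, for every stationary distribution, the steady-state queue length vector $\overline{\mathbf Q}$ satisfies $$E\big[\|\overline{\mathbf Q}_{\perp\mathcal L}\|^2\big]\le E\big[\|\overline{\mathbf Q}_{\perp\mathcal K}\|^2\big]\le K^{\star\star}.$$ -/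

import Mathlib

open scoped ENNReal

/-! ### Markov chains on discrete state spaces, given by their transition law `κ : S → PMF S` -/

/-- The law after `n` steps of the chain with transition law `κ` and initial law `μ`. -/
noncomputable def evolve {S : Type*} (κ : S → PMF S) (μ : PMF S) (n : ℕ) : PMF S :=
  (fun ν => ν.bind κ)^[n] μ

/-- `π` is a stationary (steady-state) distribution of the chain `κ`. -/
def IsSteadyState {S : Type*} (κ : S → PMF S) (π : PMF S) : Prop :=
  π.bind κ = π

/-- Every state can be reached from every state. -/
def IsIrreducibleChain {S : Type*} (κ : S → PMF S) : Prop :=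
  ∀ x y, ∃ n, evolve κ (PMF.pure x) n y ≠ 0

/-- Every state has period `1`: the only common divisor of its possible return times is `1`. -/
def IsAperiodicChain {S : Type*} (κ : S → PMF S) : Prop :=
  ∀ x, ∀ d : ℕ, (∀ n, 0 < n → evolve κ (PMF.pure x) n x ≠ 0 → d ∣ n) → d = 1

/-- The expectation of a real function on a finite space. -/
noncomputable def finMean {S : Type*} [Fintype S] (μ : PMF S) (g : S → ℝ) : ℝ :=
  ∑ x, (μ x).toReal * g x

/-- `C` and `α` are geometric mixing parameters for the functional `f` of the chain `κ`, where `lam`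
is the stationary mean of `f`: with `L = max f`, for every initial law `μ` and every `m ≥ 1`,
`|E[f(X^m) | X^0 ∼ μ] - lam| ≤ 2 L C α ^ m`. -/
def HasMixingParameters {S : Type*} [Fintype S] (κ : S → PMF S) (f : S → ℕ) (lam C α : ℝ) : Prop :=
  ∀ (μ : PMF S) (m : ℕ), 1 ≤ m →
    |finMean (evolve κ μ m) (fun y => (f y : ℝ)) - lam|
      ≤ 2 * ((Finset.univ.sup f : ℕ) : ℝ) * C * α ^ m

/-- The law of a vector of independent coordinates with laws `μ i`. -/
noncomputable def productLaw {ι S : Type*} [Fintype ι] [DecidableEq ι] [Fintype S]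
    (μ : ι → PMF S) : PMF (ι → S) :=
  PMF.ofFintype (fun x => ∏ i, μ i (x i)) (by
    rw [← Fintype.prod_sum (fun i y => μ i y)]
    refine Finset.prod_eq_one fun i _ => ?_
    rw [← tsum_fintype (L := .unconditional _)]
    exact (μ i).tsum_coe)

/-- The vector-valued chain whose coordinates are independent chains with transition laws `P i`. -/
noncomputable def productChain {ι S : Type*} [Fintype ι] [DecidableEq ι] [Fintype S]
    (P : ι → S → PMF S) : (ι → S) → PMF (ι → S) :=
  fun x => productLaw fun i => P i (x i)

/-! ### Schedules and the MaxWeight algorithm -/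

/-- Feasible schedules: `0/1` matrices with all row and column sums at most one. -/
def feasibleSchedules (N : ℕ) : Finset (Fin N × Fin N → ℕ) :=
  (Fintype.piFinset fun _ => ({0, 1} : Finset ℕ)).filter fun s =>
    (∀ i, ∑ j, s (i, j) ≤ 1) ∧ (∀ j, ∑ i, s (i, j) ≤ 1)

/-- Maximal schedules (perfect matchings): all row and column sums are equal to one. -/
def perfectMatchings (N : ℕ) : Finset (Fin N × Fin N → ℕ) :=
  (Fintype.piFinset fun _ => ({0, 1} : Finset ℕ)).filter fun s =>
    (∀ i, ∑ j, s (i, j) = 1) ∧ (∀ j, ∑ i, s (i, j) = 1)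

/-- The weight `⟨q, s⟩` of the schedule `s` at the queue lengths `q`. -/
def scheduleWeight {N : ℕ} (q s : Fin N × Fin N → ℕ) : ℕ := ∑ p, q p * s p

/-- The perfect matchings that maximize the weight among all feasible schedules. -/
def maxWeightSchedules {N : ℕ} (q : Fin N × Fin N → ℕ) : Finset (Fin N × Fin N → ℕ) :=
  (perfectMatchings N).filter fun s =>
    ∀ r ∈ feasibleSchedules N, scheduleWeight q r ≤ scheduleWeight q s

theorem maxWeightSchedules_nonempty {N : ℕ} (q : Fin N × Fin N → ℕ) :
    (maxWeightSchedules q).Nonempty := by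
  classical
  have hzero : (0 : Fin N × Fin N → ℕ) ∈ feasibleSchedules N := by
    simp [feasibleSchedules]
  obtain ⟨r, hr, hrmax⟩ := Finset.exists_max_image (feasibleSchedules N) (scheduleWeight q)
    ⟨0, hzero⟩
  obtain ⟨s, hs, hsmax⟩ := Finset.exists_max_image
    ((feasibleSchedules N).filter fun s => scheduleWeight q r ≤ scheduleWeight q s)
    (fun s => ∑ p, s p) ⟨r, by simp [hr]⟩
  rw [Finset.mem_filter] at hs
  obtain ⟨hsf, hsw⟩ := hs
  refine ⟨s, ?_⟩
  have hsf' := hsf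
  simp only [feasibleSchedules, Finset.mem_filter, Fintype.mem_piFinset] at hsf'
  obtain ⟨h01, hrow, hcol⟩ := hsf'
  have hrs : ∑ p, s p = ∑ i, ∑ j, s (i, j) := Fintype.sum_prod_type _
  have hcs : ∑ p, s p = ∑ j, ∑ i, s (i, j) := Fintype.sum_prod_type_right _
  -- an empty row together with an empty column would allow a larger schedule
  have key : ∀ i j, ∑ j', s (i, j') = 0 → ∑ i', s (i', j) = 0 → False := by
    intro i j hi hj
    have hi' : ∀ j', s (i, j') = 0 := by simpa using hi
    have hj' : ∀ i', s (i', j) = 0 := by simpa using hj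
    let t : Fin N × Fin N → ℕ := Function.update s (i, j) 1
    have ht : ∀ a b, t (a, b) = if a = i ∧ b = j then 1 else s (a, b) := by
      intro a b
      simp [t, Function.update_apply]
    have hst : ∀ p, s p ≤ t p := by
      rintro ⟨a, b⟩
      rw [ht]
      split_ifs with h
      · rw [h.1, hi']; exact Nat.zero_le _
      · exact le_rfl
    have htf : t ∈ feasibleSchedules N := by
      simp only [feasibleSchedules, Finset.mem_filter, Fintype.mem_piFinset]
      refine ⟨?_, ?_, ?_⟩
      · rintro ⟨a, b⟩
        rw [ht]
        split_ifs
        · simp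
        · exact h01 _
      · intro a
        by_cases ha : a = i
        · subst ha
          simp [ht, hi']
        · simpa [ht, ha] using hrow a
      · intro b
        by_cases hb : b = j
        · subst hb
          simp [ht, hj']
        · simpa [ht, hb] using hcol b
    have htw : scheduleWeight q r ≤ scheduleWeight q t :=
      hsw.trans (Finset.sum_le_sum fun p _ => Nat.mul_le_mul_left _ (hst p))
    have h1 := hsmax t (Finset.mem_filter.2 ⟨htf, htw⟩)
    have h2 : ∑ p, s p < ∑ p, t p :=
      Finset.sum_lt_sum (fun p _ => hst p) ⟨(i, j), Finset.mem_univ _, by simp [ht, hi']⟩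
    omega
  have hone : (∀ i, ∑ j, s (i, j) = 1) ∧ (∀ j, ∑ i, s (i, j) = 1) := by
    constructor
    · intro i
      by_contra hne
      have hi : ∑ j, s (i, j) = 0 := by have := hrow i; omega
      have hlt : ∑ a, ∑ j, s (a, j) < ∑ _a : Fin N, 1 :=
        Finset.sum_lt_sum (fun a _ => hrow a) ⟨i, Finset.mem_univ _, by omega⟩
      have hall : ∀ j ∈ Finset.univ, (1 : ℕ) ≤ ∑ a, s (a, j) := fun j _ =>
        Nat.one_le_iff_ne_zero.2 fun hj => key i j hi hj
      have := Finset.sum_le_sum hall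
      omega
    · intro j
      by_contra hne
      have hj : ∑ i, s (i, j) = 0 := by have := hcol j; omega
      have hlt : ∑ b, ∑ i, s (i, b) < ∑ _b : Fin N, 1 :=
        Finset.sum_lt_sum (fun b _ => hcol b) ⟨j, Finset.mem_univ _, by omega⟩
      have hall : ∀ i ∈ Finset.univ, (1 : ℕ) ≤ ∑ b, s (i, b) := fun i _ =>
        Nat.one_le_iff_ne_zero.2 fun hi => key i j hi hj
      have := Finset.sum_le_sum hall
      omega
  simp only [maxWeightSchedules, perfectMatchings, Finset.mem_filter, Fintype.mem_piFinset]
  exact ⟨⟨h01, hone⟩, fun a ha => (hrmax a ha).trans hsw⟩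

/-- The service vector chosen by MaxWeight at queue lengths `q`, ties being broken uniformly. -/
noncomputable def maxWeightService {N : ℕ} (q : Fin N × Fin N → ℕ) : PMF (Fin N × Fin N → ℕ) :=
  PMF.uniformOfFinset (maxWeightSchedules q) (maxWeightSchedules_nonempty q)

/-- States `(q, x)` of the switch: queue lengths and states of the modulating chains. -/
abbrev SwitchState (N : ℕ) (S : Type*) := (Fin N × Fin N → ℕ) × (Fin N × Fin N → S)

/-- One time slot of the switch under MaxWeight. At `(q, x)` the service `s` is chosen from `q`, the
arrivals are `f (x p)`, the new queue lengths are `[q p + f (x p) - s p]⁺` (truncated subtraction in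
`ℕ`), and the modulating chains make an independent step. -/
noncomputable def switchChain {N : ℕ} {S : Type*} [Fintype S] (P : Fin N × Fin N → S → PMF S)
    (f : S → ℕ) : SwitchState N S → PMF (SwitchState N S) :=
  fun z => (maxWeightService z.1).bind fun s =>
    (productChain P z.2).map fun x' => (fun p => z.1 p + f (z.2 p) - s p, x')

/-! ### Geometry of the capacity region -/

/-- `ℝ^{N²}` with its Euclidean norm; coordinates are indexed by pairs `(i, j)`. -/
abbrev MatSpace (N : ℕ) := EuclideanSpace ℝ (Fin N × Fin N)

/-- The face of the capacity region on which all input and output ports are saturated. -/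
def saturatedFace (N : ℕ) : Set (MatSpace N) :=
  {v | (∀ p, 0 ≤ v p) ∧ (∀ i, ∑ j, v (i, j) = 1) ∧ (∀ j, ∑ i, v (i, j) = 1)}

/-- The matrix with ones in row `i` and zeros elsewhere. -/
noncomputable def rowVec {N : ℕ} (i : Fin N) : MatSpace N :=
  WithLp.toLp 2 fun p => if p.1 = i then 1 else 0

/-- The matrix with ones in column `j` and zeros elsewhere. -/
noncomputable def colVec {N : ℕ} (j : Fin N) : MatSpace N :=
  WithLp.toLp 2 fun p => if p.2 = j then 1 else 0

/-- The normal cone of the saturated face. -/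
def normalCone (N : ℕ) : Set (MatSpace N) :=
  {x | ∃ w w' : Fin N → ℝ, (∀ i, 0 ≤ w i) ∧ (∀ j, 0 ≤ w' j) ∧
    x = ∑ i, w i • rowVec i + ∑ j, w' j • colVec j}

/-- The linear span of the normal cone. -/
def normalSpan (N : ℕ) : Submodule ℝ (MatSpace N) := Submodule.span ℝ (normalCone N)

/-- The projection of `x` onto `W`: a point of `W` that minimizes the distance to `x`. -/
noncomputable def projOnto {E : Type*} [NormedAddCommGroup E] (W : Set E) (x : E) : E :=
  @Classical.epsilon E ⟨0⟩ fun y => y ∈ W ∧ ∀ z ∈ W, ‖y - x‖ ≤ ‖z - x‖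

theorem exists_proj_normalCone {N : ℕ} (x : MatSpace N) :
    ∃ y ∈ normalCone N, ∀ z ∈ normalCone N, ‖y - x‖ ≤ ‖z - x‖ := by
  let T : (Fin N → ℝ) × (Fin N → ℝ) → MatSpace N := fun w =>
    ∑ i, w.1 i • rowVec i + ∑ j, w.2 j • colVec j
  have hT : ∀ w i j, T w (i, j) = w.1 i + w.2 j := by
    intro w i j
    simp [T, rowVec, colVec, WithLp.ofLp_sum, Finset.sum_apply]
  have h2 : T 0 = 0 := by simp [T]
  have hcont : Continuous T := by
    refine Continuous.add ?_ ?_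
    · exact continuous_finsetSum _ fun i _ =>
        ((continuous_apply i).comp continuous_fst).smul continuous_const
    · exact continuous_finsetSum _ fun i _ =>
        ((continuous_apply i).comp continuous_snd).smul continuous_const
  let B : Set ((Fin N → ℝ) × (Fin N → ℝ)) :=
    Set.Icc (0 : (Fin N → ℝ) × (Fin N → ℝ)) (fun _ => 2 * ‖x‖, fun _ => 2 * ‖x‖)
  have hx : (0 : ℝ) ≤ 2 * ‖x‖ := by positivity
  have hB : ∀ u : (Fin N → ℝ) × (Fin N → ℝ), 0 ≤ u → (∀ i, u.1 i ≤ 2 * ‖x‖) →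
      (∀ j, u.2 j ≤ 2 * ‖x‖) → u ∈ B := fun u h h1 h2 => ⟨h, h1, h2⟩
  have h0 : (0 : (Fin N → ℝ) × (Fin N → ℝ)) ∈ B := ⟨le_rfl, fun _ => hx, fun _ => hx⟩
  obtain ⟨w, hw, hmin⟩ := (isCompact_Icc : IsCompact B).exists_isMinOn ⟨0, h0⟩
    ((hcont.sub (continuous_const (y := x))).norm).continuousOn
  refine ⟨T w, ⟨w.1, w.2, hw.1.1, hw.1.2, rfl⟩, ?_⟩
  have hmin' : ∀ u ∈ B, ‖T w - x‖ ≤ ‖T u - x‖ := fun u hu => isMinOn_iff.1 hmin u hu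
  rintro z ⟨a, b, ha, hb, hzab⟩
  have hzT : z = T (a, b) := hzab
  rw [hzT]
  clear_value T B
  by_cases hab : (a, b) ∈ B
  · exact hmin' _ hab
  -- outside the box the origin is at least as close to `x`
  have hz : 2 * ‖x‖ < ‖T (a, b)‖ := by
    by_contra hle
    push Not at hle
    refine hab (hB _ ⟨ha, hb⟩ (fun i => ?_) fun j => ?_)
    · refine le_trans ?_ ((PiLp.norm_apply_le (T (a, b)) (i, i)).trans hle)
      rw [hT]
      exact (le_add_of_nonneg_right (hb i)).trans (le_abs_self _)
    · refine le_trans ?_ ((PiLp.norm_apply_le (T (a, b)) (j, j)).trans hle)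
      rw [hT]
      exact (le_add_of_nonneg_left (ha j)).trans (le_abs_self _)
  have h1 : ‖T w - x‖ ≤ ‖T 0 - x‖ := hmin' 0 h0
  rw [h2, zero_sub, norm_neg] at h1
  have h3 := norm_sub_norm_le (T (a, b)) x
  linarith

/-- The component `x - x_{∥ W}` of `x` perpendicular to `W`. -/
noncomputable def perpTo {E : Type*} [NormedAddCommGroup E] (W : Set E) (x : E) : E :=
  x - projOnto W x

/-- A vector of queue lengths as an element of `ℝ^{N²}`. -/
noncomputable def queueVec {N : ℕ} (q : Fin N × Fin N → ℕ) : MatSpace N :=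
  WithLp.toLp 2 fun p => (q p : ℝ)

/-- The expectation, with values in `[0, ∞]`, of a nonnegative function on a discrete space. -/
noncomputable def nonnegMean {S : Type*} (π : PMF S) (g : S → ℝ) : ℝ≥0∞ :=
  ∑' z, π z * ENNReal.ofReal (g z)

/-!
State space collapse follows from a one-step drift inequality that does not depend on `ε`.

Let `W` be the norm of the component `q_⊥` of the queue lengths perpendicular to the normal cone.
Its square is a squared distance to a convex set, so it grows by at most `2⟨q_⊥, Δq⟩` plus a
constant in one slot. Unused service occurs only at empty queues, where `q_⊥` is nonpositive, and
the MaxWeight schedule `s` satisfies `⟨q_⊥, λ - s⟩ ≤ -(vmin / 2) W`: the matrix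
`v + (vmin / W) q_⊥` is substochastic, because `q_⊥` lies in the polar cone, hence it is dominated by
a doubly stochastic matrix, and by Birkhoff's theorem MaxWeight does at least as well as that matrix
(`inner_conePerp_drift`).

The arrivals `f x` in a slot do not have conditional mean `λ`. This is repaired by a corrector: with
`h x = ∑_{k < m} (E[f (X^k) | X^0 = x] - λ)` the one-step mean of `h` is `h x - (f x - λ)` up to the
mixing error after `m` steps, which is small for some `m` that is uniform in `ε`. The Lyapunov
function `W³ + 3 W ⟨q_⊥, h x⟩`, shifted to be nonnegative, then decreases in mean by a multiple of
`W²` up to a constant (`cubic_drift`, `switch_drift`). Its cubic growth is what makes the second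
moment of `W` appear, and `IsSteadyState.pmfMean_le_of_drift` turns the drift into a bound on that
moment for every stationary law.

The same inequality with the zero cone in place of the normal cone, so with `q_⊥ = q`, has a drift of
order `ε` (`inner_queueVec_drift`). It keeps the chain tight, and a Krylov–Bogoliubov argument gives
a stationary law (`exists_isSteadyState_of_drift`).
-/

/-! ### Drift criteria for chains on discrete state spaces -/

/-- The expectation of a `[0, ∞]`-valued function on a discrete space. -/
noncomputable def pmfMean {S : Type*} (μ : PMF S) (g : S → ℝ≥0∞) : ℝ≥0∞ := ∑' z, μ z * g z

theorem pmfMean_mono {S : Type*} (μ : PMF S) {g h : S → ℝ≥0∞} (hgh : ∀ z, g z ≤ h z) :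
    pmfMean μ g ≤ pmfMean μ h :=
  ENNReal.tsum_le_tsum fun z => mul_le_mul_right (hgh z) _

theorem pmfMean_add {S : Type*} (μ : PMF S) (g h : S → ℝ≥0∞) :
    pmfMean μ (fun z => g z + h z) = pmfMean μ g + pmfMean μ h := by
  simp only [pmfMean, mul_add, ENNReal.tsum_add]

theorem pmfMean_const {S : Type*} (μ : PMF S) (c : ℝ≥0∞) : pmfMean μ (fun _ => c) = c := by
  simp only [pmfMean, ENNReal.tsum_mul_right, μ.tsum_coe, one_mul]

theorem pmfMean_bind {S T : Type*} (μ : PMF S) (κ : S → PMF T) (g : T → ℝ≥0∞) :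
    pmfMean (μ.bind κ) g = pmfMean μ fun z => pmfMean (κ z) g := by
  simp only [pmfMean, PMF.bind_apply, ← ENNReal.tsum_mul_right, ← ENNReal.tsum_mul_left]
  rw [ENNReal.tsum_comm]
  simp only [mul_assoc]

theorem pmfMean_pure {S : Type*} (a : S) (g : S → ℝ≥0∞) : pmfMean (PMF.pure a) g = g a := by
  classical
  simp only [pmfMean, PMF.pure_apply, ite_mul, one_mul, zero_mul]
  rw [tsum_eq_single a (fun b hb => by simp [hb])]
  simp

theorem pmfMean_map {S T : Type*} (μ : PMF S) (φ : S → T) (g : T → ℝ≥0∞) :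
    pmfMean (μ.map φ) g = pmfMean μ fun z => g (φ z) := by
  rw [PMF.map, pmfMean_bind]
  simp [pmfMean_pure]

/-- If `V` drifts down by `g` up to a constant `c`, then `g` has mean at most `c` under every
stationary law. Finiteness of the stationary mean of `V` is not needed: the drift inequality is
integrated for the bounded truncations `min V M`. -/
theorem IsSteadyState.pmfMean_le_of_drift {S : Type*} {κ : S → PMF S} {π : PMF S}
    (hπ : IsSteadyState κ π) {V g : S → ℝ≥0∞} (hV : ∀ z, V z ≠ ∞) {c : ℝ≥0∞}
    (h : ∀ z, pmfMean (κ z) V + g z ≤ V z + c) : pmfMean π g ≤ c := by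
  classical
  have trunc : ∀ M : ℕ, pmfMean π (fun z => if V z ≤ M then g z else 0) ≤ c := by
    intro M
    have hpt : ∀ z, pmfMean (κ z) (fun y => min (V y) M) + (if V z ≤ M then g z else 0)
        ≤ min (V z) M + c := by
      intro z
      split_ifs with hz
      · rw [min_eq_left hz]
        exact (add_le_add_left (pmfMean_mono _ fun y => min_le_left _ _) _).trans (h z)
      · rw [min_eq_right (not_le.1 hz).le, add_zero]
        refine le_trans ?_ le_self_add
        exact (pmfMean_mono _ fun y => min_le_right _ _).trans (pmfMean_const _ _).le
    have hint := pmfMean_mono π hpt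
    rw [pmfMean_add, pmfMean_add, pmfMean_const, ← pmfMean_bind, hπ] at hint
    refine (ENNReal.add_le_add_iff_left ?_).1 hint
    refine ne_top_of_le_ne_top (ENNReal.natCast_ne_top M) ?_
    exact (pmfMean_mono _ fun y => min_le_right _ _).trans (pmfMean_const _ _).le
  rw [pmfMean, ENNReal.tsum_eq_iSup_sum]
  refine iSup_le fun F => ?_
  -- on a finite set of states `V` is bounded, so some truncation level is inactive there
  obtain ⟨M, hM⟩ : ∃ M : ℕ, ∀ z ∈ F, V z ≤ M := by
    obtain ⟨M, hM⟩ := ENNReal.exists_nat_gt (r := F.sup V)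
      ((Finset.sup_lt_iff (by simp)).2 fun z _ => (hV z).lt_top).ne
    exact ⟨M, fun z hz => (Finset.le_sup hz).trans hM.le⟩
  refine le_trans (le_trans (le_of_eq ?_) (ENNReal.sum_le_tsum F)) (trunc M)
  exact Finset.sum_congr rfl fun z hz => by simp [hM z hz]

theorem evolve_succ {S : Type*} (κ : S → PMF S) (μ : PMF S) (n : ℕ) :
    evolve κ μ (n + 1) = (evolve κ μ n).bind κ :=
  Function.iterate_succ_apply' _ _ _

theorem evolve_eq_bind {S : Type*} (κ : S → PMF S) (μ : PMF S) (n : ℕ) :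
    evolve κ μ n = μ.bind fun y => evolve κ (PMF.pure y) n := by
  induction n with
  | zero => simp [evolve]
  | succ n ih => rw [evolve_succ, ih, PMF.bind_bind]; simp only [evolve_succ]

theorem evolve_pure_succ {S : Type*} (κ : S → PMF S) (y : S) (n : ℕ) :
    evolve κ (PMF.pure y) (n + 1) = (κ y).bind fun y' => evolve κ (PMF.pure y') n := by
  rw [← evolve_eq_bind]
  simp [evolve]

/-- Krylov–Bogoliubov: the drift of `V` makes the occupation measures of the chain started at a
point tight, because `g` has finite sublevel sets; a limit of these measures is stationary. -/
theorem exists_isSteadyState_of_drift {S : Type*} (κ : S → PMF S) (z₀ : S) {V g : S → ℝ≥0∞}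
    (hV : V z₀ ≠ ∞) {c : ℝ≥0∞} (hc : c ≠ ∞)
    (h : ∀ z, pmfMean (κ z) V + g z ≤ V z + c) (hg : ∀ R : ℕ, {z | g z ≤ R}.Finite) :
    ∃ π : PMF S, IsSteadyState κ π := by
  classical
  let ν : ℕ → PMF S := evolve κ (PMF.pure z₀)
  have hν : ∀ k, ν (k + 1) = (ν k).bind κ := evolve_succ _ _
  -- the occupation measure of the times `0, …, n`
  let avg : ℕ → S → ℝ≥0∞ := fun n z => ((n + 1 : ℕ) : ℝ≥0∞)⁻¹ * ∑ k ∈ Finset.range (n + 1), ν k z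
  have hn0 : ∀ n : ℕ, ((n + 1 : ℕ) : ℝ≥0∞) ≠ 0 := fun n => by simp
  have hnt : ∀ n : ℕ, ((n + 1 : ℕ) : ℝ≥0∞) ≠ ∞ := fun n => ENNReal.natCast_ne_top _
  have hmean : ∀ n (u : S → ℝ≥0∞), ∑' z, avg n z * u z =
      ((n + 1 : ℕ) : ℝ≥0∞)⁻¹ * ∑ k ∈ Finset.range (n + 1), pmfMean (ν k) u := by
    intro n u
    simp only [avg, pmfMean, mul_assoc, Finset.sum_mul, ENNReal.tsum_mul_left]
    rw [Summable.tsum_finsetSum fun _ _ => ENNReal.summable]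
  have hone : ∀ n, ∑' z, avg n z = 1 := by
    intro n
    have := hmean n 1
    simp only [Pi.one_apply, mul_one] at this
    rw [this, Finset.sum_congr rfl fun k _ => show pmfMean (ν k) 1 = 1 from pmfMean_const _ 1]
    simp only [Finset.sum_const, Finset.card_range, nsmul_eq_mul, mul_one]
    exact ENNReal.inv_mul_cancel (hn0 n) (hnt n)
  have hsum : ∀ n, ∑ k ∈ Finset.range n, pmfMean (ν k) g + pmfMean (ν n) V ≤ V z₀ + n * c := by
    intro n
    induction n with
    | zero => simp [ν, evolve, pmfMean_pure]
    | succ n ih =>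
      have h1 := pmfMean_mono (ν n) h
      rw [pmfMean_add, pmfMean_add, pmfMean_const, ← pmfMean_bind, ← hν] at h1
      rw [Finset.sum_range_succ, add_assoc, add_comm (pmfMean (ν n) g)]
      refine (add_le_add_right h1 _).trans ?_
      rw [← add_assoc]
      refine (add_le_add_left ih _).trans (le_of_eq ?_)
      push_cast
      ring
  set B : ℝ≥0∞ := V z₀ + c with hB
  have hBt : B ≠ ∞ := ENNReal.add_ne_top.2 ⟨hV, hc⟩
  have hgB : ∀ n, ∑' z, avg n z * g z ≤ B := by
    intro n
    rw [hmean, ← ENNReal.div_eq_inv_mul]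
    refine ENNReal.div_le_of_le_mul ((le_self_add.trans (hsum (n + 1))).trans ?_)
    rw [hB, add_mul, mul_comm c]
    gcongr
    exact le_mul_of_one_le_right zero_le (by simp)
  obtain ⟨ρ, hρ⟩ : ∃ ρ : S → ℝ≥0∞, ∀ z, Filter.Tendsto (fun n => avg n z)
      (Filter.hyperfilter ℕ : Filter ℕ) (nhds (ρ z)) := by
    have : ∀ z, ∃ r, Filter.Tendsto (fun n => avg n z)
        (Filter.hyperfilter ℕ : Filter ℕ) (nhds r) := by
      intro z
      obtain ⟨r, -, hr⟩ := isCompact_univ.ultrafilter_le_nhds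
        ((Filter.hyperfilter ℕ).map fun n => avg n z) (by simp)
      exact ⟨r, hr⟩
    exact ⟨fun z => (this z).choose, fun z => (this z).choose_spec⟩
  have hle : ∑' z, ρ z ≤ 1 := by
    rw [ENNReal.tsum_eq_iSup_sum]
    refine iSup_le fun F => ?_
    refine le_of_tendsto (tendsto_finsetSum F fun z _ => hρ z) (Filter.Eventually.of_forall ?_)
    intro n
    exact (ENNReal.sum_le_tsum F).trans (hone n).le
  have htight : ∀ R : ℕ, 1 ≤ ∑' z, ρ z + B / ((R + 1 : ℕ) : ℝ≥0∞) := by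
    intro R
    set F := (hg (R + 1)).toFinset
    have hF : ∀ n, 1 ≤ ∑ z ∈ F, avg n z + B / ((R + 1 : ℕ) : ℝ≥0∞) := by
      intro n
      have hpt : ∀ z, avg n z ≤ (if z ∈ F then avg n z else 0)
          + avg n z * g z / ((R + 1 : ℕ) : ℝ≥0∞) := by
        intro z
        split_ifs with hz
        · exact le_self_add
        · rw [zero_add, ENNReal.le_div_iff_mul_le (Or.inl (hn0 R)) (Or.inl (hnt R))]
          gcongr
          have : ¬ g z ≤ ((R + 1 : ℕ) : ℝ≥0∞) := by simpa [F] using hz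
          exact (not_le.1 this).le
      calc 1 = ∑' z, avg n z := (hone n).symm
        _ ≤ _ := ENNReal.tsum_le_tsum hpt
        _ ≤ _ := by
          rw [ENNReal.tsum_add]
          refine add_le_add (le_of_eq ?_) ?_
          · rw [tsum_eq_sum (s := F) fun z hz => by simp [hz]]
            exact Finset.sum_congr rfl fun z hz => by simp [hz]
          · simp only [div_eq_mul_inv]
            rw [ENNReal.tsum_mul_right]
            exact mul_le_mul_left (hgB n) _
    refine le_trans ?_ (add_le_add_left (ENNReal.sum_le_tsum F) _)
    exact ge_of_tendsto ((tendsto_finsetSum F fun z _ => hρ z).add tendsto_const_nhds)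
      (Filter.Eventually.of_forall hF)
  have hge : 1 ≤ ∑' z, ρ z := by
    have hlim : Filter.Tendsto (fun R : ℕ => ∑' z, ρ z + B / ((R + 1 : ℕ) : ℝ≥0∞)) Filter.atTop
        (nhds (∑' z, ρ z + 0)) := by
      refine tendsto_const_nhds.add ?_
      exact (Filter.tendsto_add_atTop_iff_nat 1).2
        (ENNReal.Tendsto.const_div ENNReal.tendsto_nat_nhds_top (Or.inr hBt) |>.trans (by simp))
    rw [add_zero] at hlim
    exact ge_of_tendsto hlim (Filter.Eventually.of_forall htight)
  have htot : ∑' z, ρ z = 1 := le_antisymm hle hge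
  have hsub : ∀ z, ∑' y, ρ y * κ y z ≤ ρ z := by
    intro z
    rw [ENNReal.tsum_eq_iSup_sum]
    refine iSup_le fun F => ?_
    have hstep : ∀ n, ∑ y ∈ F, avg n y * κ y z ≤ avg n z + ((n + 1 : ℕ) : ℝ≥0∞)⁻¹ := by
      intro n
      refine (ENNReal.sum_le_tsum F).trans ?_
      rw [hmean n fun y => κ y z]
      simp only [avg]
      rw [← mul_add_one]
      refine mul_le_mul_right ?_ _
      have hshift : ∀ k, pmfMean (ν k) (fun y => κ y z) = ν (k + 1) z := fun k => by
        rw [hν, PMF.bind_apply]; rfl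
      simp only [hshift]
      calc ∑ k ∈ Finset.range (n + 1), ν (k + 1) z ≤ ∑ k ∈ Finset.range (n + 2), ν k z := by
            rw [Finset.sum_range_succ' _ (n + 1)]; exact le_self_add
        _ ≤ _ := by
            rw [Finset.sum_range_succ _ (n + 1)]
            exact add_le_add_right ((ν (n + 1)).coe_le_one z) _
    have hlim : Filter.Tendsto (fun n : ℕ => avg n z + ((n + 1 : ℕ) : ℝ≥0∞)⁻¹)
        (Filter.hyperfilter ℕ : Filter ℕ) (nhds (ρ z + 0)) := by
      refine (hρ z).add (Filter.Tendsto.mono_left ?_ Nat.hyperfilter_le_atTop)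
      exact (Filter.tendsto_add_atTop_iff_nat 1).2 ENNReal.tendsto_inv_nat_nhds_zero
    rw [add_zero] at hlim
    refine le_of_tendsto_of_tendsto (tendsto_finsetSum F fun y _ =>
      ENNReal.Tendsto.mul_const (hρ y) (Or.inr ((κ y).apply_ne_top z))) hlim
      (Filter.Eventually.of_forall hstep)
  let π : PMF S := ⟨ρ, htot ▸ ENNReal.summable.hasSum⟩
  refine ⟨π, ?_⟩
  refine PMF.ext fun z => ?_
  by_contra hne
  -- the total masses agree, so no coordinate can lose mass
  have hlt : (π.bind κ) z < π z := lt_of_le_of_ne (hsub z) hne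
  have := ENNReal.tsum_lt_tsum ((π.bind κ).tsum_coe_ne_top) hsub hlt
  rw [show ∑' a, ρ a = 1 from htot] at this
  exact absurd (show ∑' a, (π.bind κ) a = 1 from (π.bind κ).tsum_coe) this.ne

/-! ### Projection onto the normal cone -/

theorem rowCol_apply {N : ℕ} (w w' : Fin N → ℝ) (p : Fin N × Fin N) :
    (∑ i, w i • rowVec i + ∑ j, w' j • colVec j : MatSpace N) p = w p.1 + w' p.2 := by
  simp [rowVec, colVec, WithLp.ofLp_sum, Finset.sum_apply]

theorem inner_matSpace {N : ℕ} (x y : MatSpace N) : inner ℝ x y = ∑ p, x p * y p := by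
  simp [PiLp.inner_apply, mul_comm]

theorem inner_rowVec {N : ℕ} (x : MatSpace N) (i : Fin N) :
    inner ℝ x (rowVec i) = ∑ j, x (i, j) := by
  rw [inner_matSpace, Fintype.sum_prod_type]
  simp [rowVec]

theorem inner_colVec {N : ℕ} (x : MatSpace N) (j : Fin N) :
    inner ℝ x (colVec j) = ∑ i, x (i, j) := by
  rw [inner_matSpace, Fintype.sum_prod_type]
  simp [colVec]

theorem normalCone_nonneg {N : ℕ} {x : MatSpace N} (hx : x ∈ normalCone N) (p : Fin N × Fin N) :
    0 ≤ x p := by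
  obtain ⟨w, w', hw, hw', rfl⟩ := hx
  rw [rowCol_apply]
  exact add_nonneg (hw _) (hw' _)

theorem normalCone_add {N : ℕ} {x y : MatSpace N} (hx : x ∈ normalCone N)
    (hy : y ∈ normalCone N) : x + y ∈ normalCone N := by
  obtain ⟨w, w', hw, hw', rfl⟩ := hx
  obtain ⟨u, u', hu, hu', rfl⟩ := hy
  refine ⟨w + u, w' + u', fun i => add_nonneg (hw i) (hu i), fun j => add_nonneg (hw' j) (hu' j), ?_⟩
  simp only [Pi.add_apply, add_smul, Finset.sum_add_distrib]
  abel

theorem normalCone_smul {N : ℕ} {x : MatSpace N} (hx : x ∈ normalCone N) {t : ℝ} (ht : 0 ≤ t) :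
    t • x ∈ normalCone N := by
  obtain ⟨w, w', hw, hw', rfl⟩ := hx
  refine ⟨t • w, t • w', fun i => mul_nonneg ht (hw i), fun j => mul_nonneg ht (hw' j), ?_⟩
  simp [smul_add, Finset.smul_sum, smul_smul]

theorem rowVec_mem_normalCone {N : ℕ} (i : Fin N) : rowVec i ∈ normalCone N :=
  ⟨Pi.single i 1, 0, fun k => by by_cases h : k = i <;> simp [h], fun _ => le_rfl,
    by simp [Pi.single_apply]⟩

theorem colVec_mem_normalCone {N : ℕ} (j : Fin N) : colVec j ∈ normalCone N :=
  ⟨0, Pi.single j 1, fun _ => le_rfl, fun k => by by_cases h : k = j <;> simp [h],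
    by simp [Pi.single_apply]⟩

theorem projOnto_spec {E : Type*} [NormedAddCommGroup E] {W : Set E} {x : E}
    (h : ∃ y ∈ W, ∀ z ∈ W, ‖y - x‖ ≤ ‖z - x‖) :
    projOnto W x ∈ W ∧ ∀ z ∈ W, ‖projOnto W x - x‖ ≤ ‖z - x‖ :=
  Classical.epsilon_spec (p := fun y => y ∈ W ∧ ∀ z ∈ W, ‖y - x‖ ≤ ‖z - x‖) h

/-- The projection onto the normal cone. -/
noncomputable def conePar {N : ℕ} (x : MatSpace N) : MatSpace N := projOnto (normalCone N) x

/-- The component perpendicular to the normal cone. -/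
noncomputable def conePerp {N : ℕ} (x : MatSpace N) : MatSpace N := perpTo (normalCone N) x

theorem conePar_mem {N : ℕ} (x : MatSpace N) : conePar x ∈ normalCone N :=
  (projOnto_spec (exists_proj_normalCone x)).1

theorem conePar_add_conePerp {N : ℕ} (x : MatSpace N) : conePar x + conePerp x = x := by
  simp [conePar, conePerp, perpTo]

theorem norm_conePerp_le {N : ℕ} (x : MatSpace N) {z : MatSpace N} (hz : z ∈ normalCone N) :
    ‖conePerp x‖ ≤ ‖x - z‖ := by
  rw [norm_sub_rev x z, conePerp, perpTo, norm_sub_rev]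
  exact (projOnto_spec (exists_proj_normalCone x)).2 z hz

/-- A vector that is not shortened by subtracting small positive multiples of `z` makes an obtuse angle
with `z`. -/
theorem inner_nonpos_of_norm_le {E : Type*} [NormedAddCommGroup E] [InnerProductSpace ℝ E]
    {x z : E} {T : ℝ} (hT : 0 < T) (h : ∀ t, 0 < t → t < T → ‖x‖ ≤ ‖x - t • z‖) :
    inner ℝ x z ≤ 0 := by
  have key : ∀ t, 0 < t → t < T → 2 * inner ℝ x z ≤ t * ‖z‖ ^ 2 := by
    intro t ht htT
    have h1 := pow_le_pow_left₀ (norm_nonneg x) (h t ht htT) 2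
    rw [norm_sub_sq_real, inner_smul_right, norm_smul, mul_pow, Real.norm_eq_abs, sq_abs] at h1
    have h2 : t * (2 * inner ℝ x z) ≤ t * (t * ‖z‖ ^ 2) := by nlinarith
    exact le_of_mul_le_mul_left h2 ht
  by_contra! hpos
  have hz : 0 ≤ ‖z‖ ^ 2 := by positivity
  let t := min (T / 2) (inner ℝ x z / (‖z‖ ^ 2 + 1))
  have ht : 0 < t := lt_min (by positivity) (by positivity)
  have h1 := key t ht ((min_le_left _ _).trans_lt (by linarith))
  have h2 : t * (‖z‖ ^ 2 + 1) ≤ inner ℝ x z :=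
    (le_div_iff₀ (by positivity)).1 (min_le_right _ _)
  nlinarith

theorem inner_conePerp_nonpos {N : ℕ} (x : MatSpace N) {z : MatSpace N} (hz : z ∈ normalCone N) :
    inner ℝ (conePerp x) z ≤ 0 := by
  refine inner_nonpos_of_norm_le one_pos fun t ht _ => ?_
  have := norm_conePerp_le x (normalCone_add (conePar_mem x) (normalCone_smul hz ht.le))
  rwa [← sub_sub, sub_eq_iff_eq_add'.2 (conePar_add_conePerp x).symm] at this

theorem inner_conePerp_conePar {N : ℕ} (x : MatSpace N) :
    inner ℝ (conePerp x) (conePar x) = 0 := by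
  refine le_antisymm (inner_conePerp_nonpos x (conePar_mem x)) ?_
  have : inner ℝ (conePerp x) (-conePar x) ≤ 0 := by
    refine inner_nonpos_of_norm_le one_pos fun t ht ht1 => ?_
    have := norm_conePerp_le x (normalCone_smul (conePar_mem x) (sub_nonneg.2 ht1.le))
    have h2 : x - (1 - t) • conePar x = conePerp x - t • -conePar x := by
      rw [eq_sub_of_add_eq' (conePar_add_conePerp x)]
      simp only [sub_smul, smul_neg, one_smul]
      abel
    rwa [h2] at this
  rw [inner_neg_right] at this
  linarith

theorem norm_conePerp_sub_le {N : ℕ} (x y : MatSpace N) :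
    ‖conePerp x - conePerp y‖ ≤ ‖x - y‖ := by
  have h1 := inner_conePerp_nonpos x (conePar_mem y)
  have h2 := inner_conePerp_nonpos y (conePar_mem x)
  have h3 := inner_conePerp_conePar x
  have h4 := inner_conePerp_conePar y
  have h5 : ‖x - y‖ ^ 2 = ‖(conePar x - conePar y) + (conePerp x - conePerp y)‖ ^ 2 := by
    conv_lhs => rw [← conePar_add_conePerp x, ← conePar_add_conePerp y]
    congr 2
    abel
  have h6 : 0 ≤ inner ℝ (conePar x - conePar y) (conePerp x - conePerp y) := by
    rw [real_inner_comm]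
    simp only [inner_sub_left, inner_sub_right]
    linarith
  rw [norm_add_sq_real] at h5
  refine le_of_sq_le_sq ?_ (norm_nonneg _)
  nlinarith [sq_nonneg ‖conePar x - conePar y‖]

theorem norm_conePerp_le_add {N : ℕ} (x y : MatSpace N) :
    ‖conePerp y‖ ≤ ‖conePerp x + (y - x)‖ := by
  have := norm_conePerp_le y (conePar_mem x)
  have h : conePerp x + (y - x) = y - conePar x := by
    conv_lhs => rw [← sub_eq_iff_eq_add'.2 (conePar_add_conePerp x).symm]
    abel
  rwa [h]

/-- The distance to the span of the cone is at most the distance to the cone. -/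
theorem norm_perpTo_normalSpan_le {N : ℕ} (x : MatSpace N) :
    ‖perpTo (normalSpan N : Set (MatSpace N)) x‖ ≤ ‖perpTo (normalCone N) x‖ := by
  have hex : ∃ y ∈ (normalSpan N : Set (MatSpace N)),
      ∀ z ∈ (normalSpan N : Set (MatSpace N)), ‖y - x‖ ≤ ‖z - x‖ := by
    refine ⟨(normalSpan N).starProjection x, by simp, fun z hz => ?_⟩
    rw [norm_sub_rev, norm_sub_rev z, Submodule.starProjection_minimal]
    exact ciInf_le ⟨0, by rintro _ ⟨w, rfl⟩; positivity⟩ (⟨z, hz⟩ : normalSpan N)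
  have := (projOnto_spec hex).2 _ (Submodule.subset_span (conePar_mem x))
  rwa [norm_sub_rev, norm_sub_rev (conePar x)] at this

/-! ### MaxWeight schedules dominate substochastic matrices -/

theorem mem_feasibleSchedules_of_perm {N : ℕ} (σ : Equiv.Perm (Fin N)) :
    (fun p => if σ p.1 = p.2 then 1 else 0) ∈ feasibleSchedules N := by
  simp only [feasibleSchedules, Finset.mem_filter, Fintype.mem_piFinset]
  refine ⟨fun p => by split_ifs <;> simp, fun i => by simp, fun j => ?_⟩
  simp [← Equiv.eq_symm_apply]

theorem sum_mul_le_of_mem_doublyStochastic {N : ℕ} {q s : Fin N × Fin N → ℕ}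
    (hs : s ∈ maxWeightSchedules q) {M : Matrix (Fin N) (Fin N) ℝ}
    (hM : M ∈ doublyStochastic ℝ (Fin N)) :
    ∑ p, (q p : ℝ) * M p.1 p.2 ≤ ∑ p, (q p : ℝ) * s p := by
  obtain ⟨w, hw0, hw1, rfl⟩ := exists_eq_sum_perm_of_mem_doublyStochastic hM
  have hσ : ∀ σ : Equiv.Perm (Fin N),
      ∑ p : Fin N × Fin N, (q p : ℝ) * σ.permMatrix ℝ p.1 p.2 ≤ ∑ p, (q p : ℝ) * s p := by
    intro σ
    have h1 := (Finset.mem_filter.1 hs).2 _ (mem_feasibleSchedules_of_perm σ)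
    have h2 : ((scheduleWeight q fun p => if σ p.1 = p.2 then 1 else 0 : ℕ) : ℝ)
        ≤ (scheduleWeight q s : ℕ) := by exact_mod_cast h1
    simp only [scheduleWeight, Nat.cast_sum, Nat.cast_mul] at h2
    refine le_trans (le_of_eq (Finset.sum_congr rfl fun p _ => ?_)) h2
    simp [PEquiv.toMatrix_apply, eq_comm]
  calc ∑ p : Fin N × Fin N, (q p : ℝ) * (∑ σ, w σ • σ.permMatrix ℝ) p.1 p.2
      = ∑ σ, w σ * ∑ p : Fin N × Fin N, (q p : ℝ) * σ.permMatrix ℝ p.1 p.2 := by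
        simp only [Matrix.sum_apply, Matrix.smul_apply, smul_eq_mul, Finset.mul_sum]
        rw [Finset.sum_comm]
        exact Finset.sum_congr rfl fun _ _ => Finset.sum_congr rfl fun _ _ => by ring
    _ ≤ ∑ σ, w σ * ∑ p, (q p : ℝ) * s p :=
        Finset.sum_le_sum fun σ _ => mul_le_mul_of_nonneg_left (hσ σ) (hw0 σ)
    _ = ∑ p, (q p : ℝ) * s p := by rw [← Finset.sum_mul, hw1, one_mul]

/-- With row deficits `a` and column deficits `b`, which have the same sum `σ`, adding the
nonnegative matrix `a bᵀ / σ` makes a substochastic matrix doubly stochastic. -/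
theorem exists_doublyStochastic_ge {N : ℕ} (r : Matrix (Fin N) (Fin N) ℝ) (h0 : ∀ i j, 0 ≤ r i j)
    (hrow : ∀ i, ∑ j, r i j ≤ 1) (hcol : ∀ j, ∑ i, r i j ≤ 1) :
    ∃ M ∈ doublyStochastic ℝ (Fin N), ∀ i j, r i j ≤ M i j := by
  set a : Fin N → ℝ := fun i => 1 - ∑ j, r i j with ha
  set b : Fin N → ℝ := fun j => 1 - ∑ i, r i j with hb
  have ha0 : ∀ i, 0 ≤ a i := fun i => sub_nonneg.2 (hrow i)
  have hb0 : ∀ j, 0 ≤ b j := fun j => sub_nonneg.2 (hcol j)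
  have hab : ∑ i, a i = ∑ j, b j := by
    simp only [ha, hb, Finset.sum_sub_distrib]
    rw [Finset.sum_comm]
  have hσ0 : 0 ≤ ∑ i, a i := Finset.sum_nonneg fun i _ => ha0 i
  -- if `σ = 0` all deficits vanish and the division by zero adds nothing
  have hA : ∀ i, a i * (∑ j, b j) / (∑ i, a i) = a i := by
    intro i
    rw [← hab]
    rcases hσ0.eq_or_lt with h | h
    · rw [← h, (Finset.sum_eq_zero_iff_of_nonneg fun i _ => ha0 i).1 h.symm i (Finset.mem_univ i)]
      simp
    · field_simp
  have hB : ∀ j, (∑ i, a i) * b j / (∑ i, a i) = b j := by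
    intro j
    rcases hσ0.eq_or_lt with h | h
    · rw [hab] at h
      rw [(Finset.sum_eq_zero_iff_of_nonneg fun i _ => hb0 i).1 h.symm j (Finset.mem_univ j)]
      simp
    · field_simp
  refine ⟨fun i j => r i j + a i * b j / ∑ i, a i, mem_doublyStochastic_iff_sum.2 ⟨?_, ?_, ?_⟩, ?_⟩
  · exact fun i j => add_nonneg (h0 i j) (div_nonneg (mul_nonneg (ha0 i) (hb0 j)) hσ0)
  · intro i
    rw [Finset.sum_add_distrib, ← Finset.sum_div, ← Finset.mul_sum, hA]
    simp [ha]
  · intro j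
    rw [Finset.sum_add_distrib, ← Finset.sum_div, ← Finset.sum_mul, hB]
    simp [hb]
  · exact fun i j => le_add_of_nonneg_right (div_nonneg (mul_nonneg (ha0 i) (hb0 j)) hσ0)

theorem inner_le_of_mem_maxWeightSchedules {N : ℕ} {q s : Fin N × Fin N → ℕ}
    (hs : s ∈ maxWeightSchedules q) (r : MatSpace N) (h0 : ∀ p, 0 ≤ r p)
    (hrow : ∀ i, ∑ j, r (i, j) ≤ 1) (hcol : ∀ j, ∑ i, r (i, j) ≤ 1) :
    inner ℝ (queueVec q) r ≤ inner ℝ (queueVec q) (queueVec s) := by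
  obtain ⟨M, hM, hrM⟩ := exists_doublyStochastic_ge (fun i j => r (i, j)) (fun i j => h0 _) hrow hcol
  rw [inner_matSpace, inner_matSpace]
  refine le_trans ?_ (sum_mul_le_of_mem_doublyStochastic hs hM)
  exact Finset.sum_le_sum fun p _ => mul_le_mul_of_nonneg_left (hrM p.1 p.2) (by simp [queueVec])

theorem queueVec_mem_saturatedFace {N : ℕ} {q s : Fin N × Fin N → ℕ}
    (hs : s ∈ maxWeightSchedules q) : queueVec s ∈ saturatedFace N := by
  have h := (Finset.mem_filter.1 (Finset.mem_filter.1 hs).1).2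
  refine ⟨fun p => by simp [queueVec], fun i => ?_, fun j => ?_⟩
  · simp only [queueVec]; exact_mod_cast h.1 i
  · simp only [queueVec]; exact_mod_cast h.2 j

/-- All elements of the saturated face have the same inner product with a given vector of the
normal cone. -/
theorem inner_normalCone_eq {N : ℕ} {x u u' : MatSpace N} (hx : x ∈ normalCone N)
    (hu : u ∈ saturatedFace N) (hu' : u' ∈ saturatedFace N) : inner ℝ x u = inner ℝ x u' := by
  obtain ⟨w, w', -, -, rfl⟩ := hx
  have h : ∀ y ∈ saturatedFace N,
      inner ℝ (∑ i, w i • rowVec i + ∑ j, w' j • colVec j) y = ∑ i, w i + ∑ j, w' j := by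
    intro y hy
    rw [real_inner_comm, inner_add_right, inner_sum, inner_sum]
    simp [inner_smul_right, inner_rowVec, inner_colVec, hy.2.1, hy.2.2]
  rw [h u hu, h u' hu']

/-- MaxWeight pushes the perpendicular component down at rate `vmin / 2`: since `v` has positive
entries and the perpendicular component lies in the polar cone, moving from `v` a distance `vmin`
along it stays substochastic. -/
theorem inner_conePerp_drift {N : ℕ} {q s : Fin N × Fin N → ℕ} (hs : s ∈ maxWeightSchedules q)
    {v : MatSpace N} (hv : v ∈ saturatedFace N) {b : ℝ} (hb : 0 < b) (hbv : ∀ p, b ≤ v p)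
    {ε : ℝ} (hε : 0 ≤ ε) (hε' : ε * ‖v‖ ≤ b / 2) :
    inner ℝ (conePerp (queueVec q)) ((1 - ε) • v - queueVec s)
      ≤ -(b / 2) * ‖conePerp (queueVec q)‖ := by
  set x := conePerp (queueVec q) with hx
  have hq := conePar_add_conePerp (queueVec q)
  rcases (norm_nonneg x).eq_or_lt with hW | hW
  · have : x = 0 := norm_eq_zero.1 hW.symm
    simp [this]
  set t := b / ‖x‖ with ht
  have ht0 : 0 < t := by positivity
  have htx : t * ‖x‖ = b := by rw [ht]; field_simp
  have hmax := inner_le_of_mem_maxWeightSchedules hs (v + t • x) (fun p => by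
      have h1 := PiLp.norm_apply_le x p
      have h2 : t * ‖x p‖ ≤ b := by rw [← htx]; gcongr
      have h3 : -(t * ‖x p‖) ≤ t * x p := by
        rw [← mul_neg]; exact mul_le_mul_of_nonneg_left (neg_abs_le _) ht0.le
      have := hbv p
      simp only [PiLp.add_apply, PiLp.smul_apply, smul_eq_mul]
      linarith)
    (fun i => by
      have := inner_conePerp_nonpos (queueVec q) (rowVec_mem_normalCone i)
      rw [inner_rowVec] at this
      simp only [PiLp.add_apply, PiLp.smul_apply, smul_eq_mul, Finset.sum_add_distrib,
        ← Finset.mul_sum, hv.2.1]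
      nlinarith)
    (fun j => by
      have := inner_conePerp_nonpos (queueVec q) (colVec_mem_normalCone j)
      rw [inner_colVec] at this
      simp only [PiLp.add_apply, PiLp.smul_apply, smul_eq_mul, Finset.sum_add_distrib,
        ← Finset.mul_sum, hv.2.2]
      nlinarith)
  have hface := inner_normalCone_eq (conePar_mem (queueVec q)) (queueVec_mem_saturatedFace hs) hv
  have horth := inner_conePerp_conePar (queueVec q)
  rw [real_inner_comm] at horth
  rw [← hq] at hmax
  simp only [inner_add_left, inner_add_right, inner_smul_right, ← hx] at hmax horth
  rw [real_inner_self_eq_norm_sq] at hmax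
  have hxv : -(‖x‖ * ‖v‖) ≤ inner ℝ x v := (abs_le.1 (abs_real_inner_le_norm x v)).1
  rw [inner_sub_right, inner_smul_right]
  have h5 : t * ‖x‖ ^ 2 = b * ‖x‖ := by rw [pow_two, ← mul_assoc, htx]
  nlinarith [mul_le_mul_of_nonneg_left hxv hε, mul_le_mul_of_nonneg_right hε' hW.le]

/-- The component perpendicular to the cone is nonpositive on queues that are empty. -/
theorem inner_conePerp_nonpos_of_support {N : ℕ} (q : Fin N × Fin N → ℕ) (u : MatSpace N)
    (hu : ∀ p, 0 ≤ u p) (hqu : ∀ p, u p ≠ 0 → q p = 0) :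
    inner ℝ (conePerp (queueVec q)) u ≤ 0 := by
  rw [inner_matSpace]
  refine Finset.sum_nonpos fun p _ => ?_
  by_cases hp : u p = 0
  · simp [hp]
  · have h1 : conePerp (queueVec q) p = -conePar (queueVec q) p := by
      have := congrArg (fun z : MatSpace N => z p) (conePar_add_conePerp (queueVec q))
      simp only [PiLp.add_apply, queueVec, hqu p hp, Nat.cast_zero] at this
      simp only [queueVec]
      linarith
    rw [h1]
    nlinarith [mul_nonneg (normalCone_nonneg (conePar_mem (queueVec q)) p) (hu p)]

theorem norm_queueVec_le_sum {N : ℕ} (q : Fin N × Fin N → ℕ) :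
    ‖queueVec q‖ ≤ ∑ p, (q p : ℝ) := by
  have h0 : (0 : ℝ) ≤ ∑ p, (q p : ℝ) := by positivity
  refine le_of_sq_le_sq ?_ h0
  rw [EuclideanSpace.norm_sq_eq, pow_two, Finset.sum_mul]
  refine Finset.sum_le_sum fun p _ => ?_
  simp only [queueVec, Real.norm_eq_abs, sq_abs]
  rw [pow_two]
  exact mul_le_mul_of_nonneg_left
    (Finset.single_le_sum (f := fun p => (q p : ℝ)) (fun _ _ => by positivity) (Finset.mem_univ p))
    (by positivity)

/-- MaxWeight stabilizes the queues inside the capacity region. -/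
theorem inner_queueVec_drift {N : ℕ} {q s : Fin N × Fin N → ℕ} (hs : s ∈ maxWeightSchedules q)
    {v : MatSpace N} (hv : v ∈ saturatedFace N) {b : ℝ} (hb : 0 < b) (hbv : ∀ p, b ≤ v p)
    {ε : ℝ} (hε : 0 ≤ ε) :
    inner ℝ (queueVec q) ((1 - ε) • v - queueVec s) ≤ -(ε * b) * ‖queueVec q‖ := by
  have hmax := inner_le_of_mem_maxWeightSchedules hs v hv.1 (fun i => (hv.2.1 i).le)
    fun j => (hv.2.2 j).le
  have h1 : b * ‖queueVec q‖ ≤ inner ℝ (queueVec q) v := by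
    refine (mul_le_mul_of_nonneg_left (norm_queueVec_le_sum q) hb.le).trans ?_
    rw [inner_matSpace, Finset.mul_sum]
    refine Finset.sum_le_sum fun p _ => ?_
    rw [mul_comm]
    exact mul_le_mul_of_nonneg_left (hbv p) (by simp)
  rw [inner_sub_right, inner_smul_right]
  nlinarith [mul_le_mul_of_nonneg_left h1 hε]

/-! ### Means of the modulating chains -/

theorem finMean_add {S : Type*} [Fintype S] (μ : PMF S) (g h : S → ℝ) :
    finMean μ (fun x => g x + h x) = finMean μ g + finMean μ h := by
  simp only [finMean, mul_add, Finset.sum_add_distrib]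

theorem finMean_mul_left {S : Type*} [Fintype S] (μ : PMF S) (c : ℝ) (g : S → ℝ) :
    finMean μ (fun x => c * g x) = c * finMean μ g := by
  simp only [finMean, Finset.mul_sum]
  exact Finset.sum_congr rfl fun _ _ => by ring

theorem finMean_sum {S ι : Type*} [Fintype S] (μ : PMF S) (F : Finset ι) (g : ι → S → ℝ) :
    finMean μ (fun x => ∑ k ∈ F, g k x) = ∑ k ∈ F, finMean μ (g k) := by
  simp only [finMean, Finset.mul_sum]
  exact Finset.sum_comm

theorem sum_toReal_eq_one {S : Type*} [Fintype S] (μ : PMF S) : ∑ x, (μ x).toReal = 1 := by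
  rw [← ENNReal.toReal_sum fun x _ => μ.apply_ne_top x, ← tsum_fintype (L := .unconditional _),
    μ.tsum_coe, ENNReal.toReal_one]

theorem finMean_const {S : Type*} [Fintype S] (μ : PMF S) (c : ℝ) :
    finMean μ (fun _ => c) = c := by
  rw [finMean, ← Finset.sum_mul, sum_toReal_eq_one, one_mul]

theorem finMean_mono {S : Type*} [Fintype S] (μ : PMF S) {g h : S → ℝ} (hgh : ∀ x, g x ≤ h x) :
    finMean μ g ≤ finMean μ h :=
  Finset.sum_le_sum fun x _ => mul_le_mul_of_nonneg_left (hgh x) ENNReal.toReal_nonneg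

theorem finMean_bind {S T : Type*} [Fintype S] [Fintype T] (μ : PMF S) (κ : S → PMF T)
    (g : T → ℝ) : finMean (μ.bind κ) g = finMean μ fun x => finMean (κ x) g := by
  have h : ∀ y, ((μ.bind κ) y).toReal = ∑ x, (μ x).toReal * (κ x y).toReal := by
    intro y
    rw [PMF.bind_apply, tsum_fintype, ENNReal.toReal_sum fun x _ =>
      ENNReal.mul_ne_top (μ.apply_ne_top x) ((κ x).apply_ne_top y)]
    simp only [ENNReal.toReal_mul]
  simp only [finMean, h, Finset.sum_mul, Finset.mul_sum]
  rw [Finset.sum_comm]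
  simp only [mul_assoc]

theorem finMean_productLaw_apply {ι S : Type*} [Fintype ι] [DecidableEq ι] [Fintype S]
    (μ : ι → PMF S) (p : ι) (g : S → ℝ) :
    finMean (productLaw μ) (fun x => g (x p)) = finMean (μ p) g := by
  have h : ∀ x : ι → S, (productLaw μ x).toReal * g (x p)
      = ∏ i, (μ i (x i)).toReal * (if i = p then g (x i) else 1) := by
    intro x
    rw [Finset.prod_mul_distrib, Fintype.prod_ite_eq', productLaw, PMF.ofFintype_apply,
      ENNReal.toReal_prod]
  simp only [finMean, h]
  rw [← Fintype.prod_sum fun i y => (μ i y).toReal * (if i = p then g y else 1),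
    Finset.prod_eq_single p]
  · simp
  · intro i _ hi
    simp [hi, sum_toReal_eq_one]
  · simp

theorem pmfMean_ofReal {S : Type*} [Fintype S] (μ : PMF S) {g : S → ℝ} (hg : ∀ x, 0 ≤ g x) :
    pmfMean μ (fun x => ENNReal.ofReal (g x)) = ENNReal.ofReal (finMean μ g) := by
  rw [pmfMean, finMean, tsum_fintype, ENNReal.ofReal_sum_of_nonneg fun x _ =>
    mul_nonneg ENNReal.toReal_nonneg (hg x)]
  refine Finset.sum_congr rfl fun x _ => ?_
  rw [ENNReal.ofReal_mul ENNReal.toReal_nonneg, ENNReal.ofReal_toReal (μ.apply_ne_top x)]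

/-- The vector of mean arrivals `k` slots later, given the current states of the modulating
chains. -/
noncomputable def meanAfter {N : ℕ} {S : Type*} [Fintype S] (P : Fin N × Fin N → S → PMF S)
    (f : S → ℕ) (k : ℕ) (x : Fin N × Fin N → S) : MatSpace N :=
  WithLp.toLp 2 fun p => finMean (evolve (P p) (PMF.pure (x p)) k) fun y => (f y : ℝ)

theorem meanAfter_zero {N : ℕ} {S : Type*} [Fintype S] (P : Fin N × Fin N → S → PMF S)
    (f : S → ℕ) (x : Fin N × Fin N → S) : meanAfter P f 0 x = queueVec fun p => f (x p) := by
  classical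
  ext p
  simp only [meanAfter, queueVec, evolve, Function.iterate_zero, id, finMean, PMF.pure_apply]
  rw [Finset.sum_eq_single (x p) (fun y _ hy => by simp [hy]) (by simp)]
  simp

theorem finMean_inner_meanAfter {N : ℕ} {S : Type*} [Fintype S] (P : Fin N × Fin N → S → PMF S)
    (f : S → ℕ) (k : ℕ) (x : Fin N × Fin N → S) (w : MatSpace N) :
    finMean (productChain P x) (fun x' => inner ℝ w (meanAfter P f k x'))
      = inner ℝ w (meanAfter P f (k + 1) x) := by
  simp only [inner_matSpace, finMean_sum, finMean_mul_left]
  refine Finset.sum_congr rfl fun p _ => ?_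
  simp only [meanAfter, productChain]
  rw [finMean_productLaw_apply (fun i => P i (x i)) p fun y =>
    finMean (evolve (P p) (PMF.pure y) k) fun y => (f y : ℝ), ← finMean_bind, ← evolve_pure_succ]

/-- The truncated solution of the Poisson equation for the arrivals: its mean changes in one step
by the deviation of the current arrivals from `lam`, up to the mixing error after `m` steps. -/
noncomputable def corrector {N : ℕ} {S : Type*} [Fintype S] (P : Fin N × Fin N → S → PMF S)
    (f : S → ℕ) (lam : MatSpace N) (m : ℕ) (x : Fin N × Fin N → S) : MatSpace N :=
  ∑ k ∈ Finset.range m, (meanAfter P f k x - lam)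

/-- The mean of the corrector after one step. -/
noncomputable def correctorNext {N : ℕ} {S : Type*} [Fintype S] (P : Fin N × Fin N → S → PMF S)
    (f : S → ℕ) (lam : MatSpace N) (m : ℕ) (x : Fin N × Fin N → S) : MatSpace N :=
  ∑ k ∈ Finset.range m, (meanAfter P f (k + 1) x - lam)

theorem correctorNext_sub_corrector {N : ℕ} {S : Type*} [Fintype S]
    (P : Fin N × Fin N → S → PMF S) (f : S → ℕ) (lam : MatSpace N) (m : ℕ)
    (x : Fin N × Fin N → S) :
    correctorNext P f lam m x - corrector P f lam m x
      = meanAfter P f m x - queueVec fun p => f (x p) := by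
  rw [correctorNext, corrector, ← Finset.sum_sub_distrib, ← meanAfter_zero P f x,
    ← Finset.sum_range_sub (fun k => meanAfter P f k x) m]
  exact Finset.sum_congr rfl fun _ _ => by abel

theorem finMean_inner_corrector {N : ℕ} {S : Type*} [Fintype S] (P : Fin N × Fin N → S → PMF S)
    (f : S → ℕ) (lam : MatSpace N) (m : ℕ) (x : Fin N × Fin N → S) (w : MatSpace N) :
    finMean (productChain P x) (fun x' => inner ℝ w (corrector P f lam m x'))
      = inner ℝ w (correctorNext P f lam m x) := by
  simp only [corrector, correctorNext, inner_sum, finMean_sum]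
  refine Finset.sum_congr rfl fun k _ => ?_
  simp only [inner_sub_right]
  simp only [sub_eq_add_neg, finMean_add, finMean_const, finMean_inner_meanAfter]

theorem norm_le_card_mul {N : ℕ} (x : MatSpace N) {c : ℝ} (hc : 0 ≤ c) (h : ∀ p, |x p| ≤ c) :
    ‖x‖ ≤ N * N * c := by
  have hN : (0 : ℝ) ≤ N * N * c := by positivity
  rcases Nat.eq_zero_or_pos N with rfl | hpos
  · have : x = 0 := by ext p; exact p.1.elim0
    simp [this]
  refine le_of_sq_le_sq ?_ hN
  rw [EuclideanSpace.norm_sq_eq]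
  calc ∑ p, ‖x p‖ ^ 2 ≤ ∑ _p : Fin N × Fin N, c ^ 2 :=
        Finset.sum_le_sum fun p _ => pow_le_pow_left₀ (norm_nonneg _) (h p) 2
    _ = (N * N : ℝ) * c ^ 2 := by simp
    _ ≤ (N * N * c) ^ 2 := by
        have h1 : (1 : ℝ) ≤ N * N := by
          have : (1 : ℝ) ≤ N := by exact_mod_cast hpos
          nlinarith
        nlinarith [mul_nonneg (sub_nonneg.2 h1) (mul_nonneg (by positivity : (0 : ℝ) ≤ N * N)
          (sq_nonneg c))]

/-- A bound for the norm of the change of the queue lengths in one slot, and of the deviation of the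
mean arrivals from their stationary mean. -/
noncomputable def slotBound (N : ℕ) {S : Type*} [Fintype S] (f : S → ℕ) : ℝ :=
  N * N * ((Finset.univ.sup f : ℕ) + 1)

theorem slotBound_nonneg (N : ℕ) {S : Type*} [Fintype S] (f : S → ℕ) : 0 ≤ slotBound N f := by
  unfold slotBound; positivity

theorem norm_meanAfter_sub_le {N : ℕ} {S : Type*} [Fintype S] (P : Fin N × Fin N → S → PMF S)
    (f : S → ℕ) {lam : MatSpace N} (h0 : ∀ p, 0 ≤ lam p) (h1 : ∀ p, lam p ≤ 1) (k : ℕ)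
    (x : Fin N × Fin N → S) : ‖meanAfter P f k x - lam‖ ≤ slotBound N f := by
  refine norm_le_card_mul _ (by positivity) fun p => ?_
  have hlo := finMean_mono (evolve (P p) (PMF.pure (x p)) k) (g := fun _ => 0)
    (h := fun y => (f y : ℝ)) fun y => by positivity
  have hhi := finMean_mono (evolve (P p) (PMF.pure (x p)) k) (g := fun y => (f y : ℝ))
    (h := fun _ => ((Finset.univ.sup f : ℕ) : ℝ)) fun y => by
      exact_mod_cast Finset.le_sup (f := f) (Finset.mem_univ y)
  rw [finMean_const] at hlo hhi
  have := h0 p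
  have := h1 p
  simp only [PiLp.sub_apply, meanAfter]
  rw [abs_le]
  constructor <;> linarith

/-! ### The cubic Lyapunov function -/

/-- The increment of the cubic Lyapunov function with corrector. Here `w` and `w'` are the
perpendicular components before and after a slot, `d` is the increment of the queue lengths, and
`h` and `g` are the corrector and its mean one step later. -/
theorem cubic_drift {E : Type*} [NormedAddCommGroup E] [InnerProductSpace ℝ E] {w w' d h g : E}
    {D H η : ℝ} (hη : 0 < η) (hww' : ‖w' - w‖ ≤ D) (hw' : ‖w'‖ ≤ ‖w + d‖) (hd : ‖d‖ ≤ D)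
    (hg : ‖g‖ ≤ H) (hdrift : inner ℝ w (d + g - h) ≤ -η * ‖w‖) :
    ‖w'‖ ^ 3 + 3 * ‖w'‖ * inner ℝ w' g + η * ‖w‖ ^ 2
      ≤ ‖w‖ ^ 3 + 3 * ‖w‖ * inner ℝ w h
        + (D ^ 3 + 3 * H * D ^ 2 + (3 * D ^ 2 + 6 * H * D) ^ 2 / (8 * η)) := by
  have hD : 0 ≤ D := (norm_nonneg d).trans hd
  have hH : 0 ≤ H := (norm_nonneg g).trans hg
  set W := ‖w‖ with hW
  set W' := ‖w'‖ with hW'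
  have hW0 : 0 ≤ W := norm_nonneg w
  have hW'0 : 0 ≤ W' := norm_nonneg w'
  have habs : |W' - W| ≤ D := (abs_norm_sub_norm_le w' w).trans hww'
  have hsq : (W' - W) ^ 2 ≤ D ^ 2 := by
    rw [← sq_abs]; exact pow_le_pow_left₀ (abs_nonneg _) habs 2
  have hW'D : W' ≤ W + D := by linarith [(abs_le.1 habs).2]
  -- the square of the distance to the cone is at most its linearization plus a bounded error
  have hquad : W' ^ 2 ≤ W ^ 2 + 2 * inner ℝ w d + D ^ 2 := by
    have h1 := pow_le_pow_left₀ hW'0 hw' 2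
    rw [norm_add_sq_real] at h1
    have h2 := pow_le_pow_left₀ (norm_nonneg d) hd 2
    linarith
  have hcube : W' ^ 3 ≤ W ^ 3 + 3 * W * inner ℝ w d + 3 * D ^ 2 * W + D ^ 3 := by
    have hid : W' ^ 3 = W ^ 3 + 3 / 2 * W * (W' ^ 2 - W ^ 2) + (W' - W) ^ 2 * (W' + W / 2) := by
      ring
    have h1 : 3 / 2 * W * (W' ^ 2 - W ^ 2) ≤ 3 / 2 * W * (2 * inner ℝ w d + D ^ 2) :=
      mul_le_mul_of_nonneg_left (by linarith) (by positivity)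
    have h2 : (W' - W) ^ 2 * (W' + W / 2) ≤ D ^ 2 * (W + D + W / 2) :=
      mul_le_mul hsq (by linarith) (by positivity) (by positivity)
    rw [hid]
    linarith
  have hcorr : W' * inner ℝ w' g ≤ W * inner ℝ w g + H * (2 * D * W + D ^ 2) := by
    have h1 : W' * inner ℝ w' g - W * inner ℝ w g
        = (W' - W) * inner ℝ w' g + W * inner ℝ (w' - w) g := by
      rw [inner_sub_left]; ring
    have h2 : (W' - W) * inner ℝ w' g ≤ D * ((W + D) * H) := by
      refine (le_abs_self _).trans ?_
      rw [abs_mul]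
      refine mul_le_mul habs ((abs_real_inner_le_norm _ _).trans ?_) (abs_nonneg _) hD
      exact mul_le_mul hW'D hg (norm_nonneg _) (by positivity)
    have h3 : W * inner ℝ (w' - w) g ≤ W * (D * H) := by
      refine mul_le_mul_of_nonneg_left ((real_inner_le_norm _ _).trans ?_) hW0
      exact mul_le_mul hww' hg (norm_nonneg _) hD
    linarith
  have hmain : 3 * W * (inner ℝ w d + inner ℝ w g - inner ℝ w h) ≤ 3 * W * (-η * W) := by
    rw [inner_sub_right, inner_add_right] at hdrift
    exact mul_le_mul_of_nonneg_left hdrift (by positivity)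
  -- complete the square to absorb the linear term
  have hyoung : (3 * D ^ 2 + 6 * H * D) * W
      ≤ 2 * η * W ^ 2 + (3 * D ^ 2 + 6 * H * D) ^ 2 / (8 * η) := by
    have h1 : 2 * η * W ^ 2 + (3 * D ^ 2 + 6 * H * D) ^ 2 / (8 * η) - (3 * D ^ 2 + 6 * H * D) * W
        = (4 * η * W - (3 * D ^ 2 + 6 * H * D)) ^ 2 / (8 * η) := by
      field_simp
      ring
    have h2 : 0 ≤ (4 * η * W - (3 * D ^ 2 + 6 * H * D)) ^ 2 / (8 * η) := by positivity
    linarith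
  linarith

theorem cubic_nonneg {E : Type*} [NormedAddCommGroup E] [InnerProductSpace ℝ E] (w h : E) {H : ℝ}
    (hh : ‖h‖ ≤ H) : 0 ≤ ‖w‖ ^ 3 + 3 * ‖w‖ * inner ℝ w h + 4 * H ^ 3 := by
  have hH : 0 ≤ H := (norm_nonneg h).trans hh
  have hW := norm_nonneg w
  have h1 : -(‖w‖ * H) ≤ inner ℝ w h := by
    have := (abs_le.1 (abs_real_inner_le_norm w h)).1
    have := mul_le_mul_of_nonneg_left hh hW
    linarith
  have h2 := mul_le_mul_of_nonneg_left h1 hW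
  have h3 : 0 ≤ (‖w‖ + H) * (‖w‖ - 2 * H) ^ 2 := by positivity
  have h4 : (‖w‖ + H) * (‖w‖ - 2 * H) ^ 2 = ‖w‖ ^ 3 - 3 * ‖w‖ * (‖w‖ * H) + 4 * H ^ 3 := by ring
  linarith

/-- The queue lengths at the end of a slot. -/
def nextQueue {N : ℕ} (q a s : Fin N × Fin N → ℕ) : Fin N × Fin N → ℕ := fun p => q p + a p - s p

theorem le_one_of_mem_maxWeightSchedules {N : ℕ} {q s : Fin N × Fin N → ℕ}
    (hs : s ∈ maxWeightSchedules q) (p : Fin N × Fin N) : s p ≤ 1 := by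
  have := Fintype.mem_piFinset.1 (Finset.mem_filter.1 (Finset.mem_filter.1 hs).1).1 p
  simp only [Finset.mem_insert, Finset.mem_singleton] at this
  omega

theorem norm_nextQueue_sub_le {N : ℕ} {S : Type*} [Fintype S] (f : S → ℕ)
    {q s : Fin N × Fin N → ℕ} (hs : s ∈ maxWeightSchedules q) (x : Fin N × Fin N → S) :
    ‖queueVec (nextQueue q (fun p => f (x p)) s) - queueVec q‖ ≤ slotBound N f := by
  refine norm_le_card_mul _ (by positivity) fun p => ?_
  have h1 := le_one_of_mem_maxWeightSchedules hs p
  have h2 : f (x p) ≤ Finset.univ.sup f := Finset.le_sup (Finset.mem_univ _)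
  have h3 : nextQueue q (fun p => f (x p)) s p ≤ q p + Finset.univ.sup f := by
    simp only [nextQueue]; omega
  have h4 : q p ≤ nextQueue q (fun p => f (x p)) s p + 1 := by
    simp only [nextQueue]; omega
  have h3' : (nextQueue q (fun p => f (x p)) s p : ℝ) ≤ q p + (Finset.univ.sup f : ℕ) := by
    exact_mod_cast h3
  have h4' : (q p : ℝ) ≤ nextQueue q (fun p => f (x p)) s p + 1 := by exact_mod_cast h4
  have h5 : (0 : ℝ) ≤ (Finset.univ.sup f : ℕ) := by positivity
  simp only [PiLp.sub_apply, queueVec]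
  rw [abs_le]
  constructor <;> linarith

/-- The unused service is nonnegative and lives on empty queues. -/
theorem inner_nextQueue_sub_le {N : ℕ} {q a s : Fin N × Fin N → ℕ}
    (hs : s ∈ maxWeightSchedules q) {w : MatSpace N}
    (hw : ∀ u : MatSpace N, (∀ p, 0 ≤ u p) → (∀ p, u p ≠ 0 → q p = 0) → inner ℝ w u ≤ 0) :
    inner ℝ w (queueVec (nextQueue q a s) - queueVec q)
      ≤ inner ℝ w (queueVec a - queueVec s) := by
  have := hw (queueVec (nextQueue q a s) - queueVec q - (queueVec a - queueVec s))
    (fun p => by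
      have h : q p + a p ≤ nextQueue q a s p + s p := by simp only [nextQueue]; omega
      have h' : (q p + a p : ℝ) ≤ nextQueue q a s p + s p := by exact_mod_cast h
      simp only [PiLp.sub_apply, queueVec]
      linarith)
    (fun p hp => by
      by_contra hq
      refine hp ?_
      have h1 := le_one_of_mem_maxWeightSchedules hs p
      have h : nextQueue q a s p + s p = q p + a p := by simp only [nextQueue]; omega
      have h' : (nextQueue q a s p + s p : ℝ) = q p + a p := by exact_mod_cast h
      simp only [PiLp.sub_apply, queueVec]
      linarith)
  rw [inner_sub_right] at this
  linarith

/-- The Lyapunov function of the switch: the cubed norm of a perpendicular component, corrected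
for the correlation of the arrivals, and shifted to be nonnegative. -/
noncomputable def switchLyapunov {N : ℕ} {S : Type*} (perp : MatSpace N → MatSpace N)
    (h : (Fin N × Fin N → S) → MatSpace N) (H : ℝ) (z : SwitchState N S) : ℝ :=
  ‖perp (queueVec z.1)‖ ^ 3 + 3 * ‖perp (queueVec z.1)‖ * inner ℝ (perp (queueVec z.1)) (h z.2)
    + 4 * H ^ 3

/-- The constant in the drift inequality of the Lyapunov function of the switch. -/
noncomputable def driftConst (D H η : ℝ) : ℝ :=
  D ^ 3 + 3 * H * D ^ 2 + (3 * D ^ 2 + 6 * H * D) ^ 2 / (8 * η)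

theorem driftConst_nonneg {D H η : ℝ} (hD : 0 ≤ D) (hH : 0 ≤ H) (hη : 0 < η) :
    0 ≤ driftConst D H η := by
  unfold driftConst; positivity

/-- The drift of the Lyapunov function, for any notion of perpendicular component that is
nonexpansive, whose norm is a distance (`hadd`), which is nonpositive on empty queues, and which
MaxWeight pushes down at rate `2 η`; half of that rate pays for the mixing error. -/
theorem switch_drift {N : ℕ} {S : Type*} [Fintype S] (P : Fin N × Fin N → S → PMF S) (f : S → ℕ)
    {lam : MatSpace N} (h0 : ∀ p, 0 ≤ lam p) (h1 : ∀ p, lam p ≤ 1)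
    {perp : MatSpace N → MatSpace N} (hlip : ∀ x y, ‖perp x - perp y‖ ≤ ‖x - y‖)
    (hadd : ∀ x y, ‖perp y‖ ≤ ‖perp x + (y - x)‖)
    (hsupp : ∀ (q : Fin N × Fin N → ℕ) (u : MatSpace N), (∀ p, 0 ≤ u p) →
      (∀ p, u p ≠ 0 → q p = 0) → inner ℝ (perp (queueVec q)) u ≤ 0)
    {η : ℝ} (hη : 0 < η)
    (hdrift : ∀ q, ∀ s ∈ maxWeightSchedules q,
      inner ℝ (perp (queueVec q)) (lam - queueVec s) ≤ -(2 * η) * ‖perp (queueVec q)‖)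
    {m : ℕ} (hm : ∀ x, ‖meanAfter P f m x - lam‖ ≤ η) (z : SwitchState N S) :
    pmfMean (switchChain P f z) (fun z' => ENNReal.ofReal
        (switchLyapunov perp (corrector P f lam m) (m * slotBound N f) z'))
      + ENNReal.ofReal (η * ‖perp (queueVec z.1)‖ ^ 2)
      ≤ ENNReal.ofReal (switchLyapunov perp (corrector P f lam m) (m * slotBound N f) z)
        + ENNReal.ofReal (driftConst (slotBound N f) (m * slotBound N f) η) := by
  obtain ⟨q, x⟩ := z
  set H := m * slotBound N f with hH
  have hcorr : ∀ x, ‖corrector P f lam m x‖ ≤ H := fun x => by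
    refine (norm_sum_le_of_le _ fun k _ => norm_meanAfter_sub_le P f h0 h1 k x).trans ?_
    simp [hH]
  have hnext : ‖correctorNext P f lam m x‖ ≤ H := by
    refine (norm_sum_le_of_le _ fun k _ => norm_meanAfter_sub_le P f h0 h1 (k + 1) x).trans ?_
    simp [hH]
  have hVnn : ∀ z : SwitchState N S, 0 ≤ switchLyapunov perp (corrector P f lam m) H z :=
    fun z => cubic_nonneg _ _ (hcorr z.2)
  have hBnn : 0 ≤ driftConst (slotBound N f) H η :=
    driftConst_nonneg (slotBound_nonneg N f)
      (mul_nonneg (Nat.cast_nonneg m) (slotBound_nonneg N f)) hη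
  -- the inequality holds for every schedule that MaxWeight may choose
  have hs : ∀ s ∈ maxWeightSchedules q,
      pmfMean (productChain P x) (fun x' => ENNReal.ofReal
        (switchLyapunov perp (corrector P f lam m) H (nextQueue q (fun p => f (x p)) s, x')))
      + ENNReal.ofReal (η * ‖perp (queueVec q)‖ ^ 2)
      ≤ ENNReal.ofReal (switchLyapunov perp (corrector P f lam m) H (q, x))
        + ENNReal.ofReal (driftConst (slotBound N f) H η) := by
    intro s hs
    rw [pmfMean_ofReal _ fun x' => hVnn _, ← ENNReal.ofReal_add (hVnn _) hBnn,
      ← ENNReal.ofReal_add ?_ (by positivity)]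
    · refine ENNReal.ofReal_le_ofReal ?_
      simp only [switchLyapunov, finMean_add, finMean_mul_left, finMean_const,
        finMean_inner_corrector]
      have hd := norm_nextQueue_sub_le f hs x
      have hw := inner_nextQueue_sub_le (a := fun p => f (x p)) hs (hsupp q)
      have hc := correctorNext_sub_corrector P f lam m x
      have hcub := cubic_drift (w := perp (queueVec q))
        (w' := perp (queueVec (nextQueue q (fun p => f (x p)) s)))
        (d := queueVec (nextQueue q (fun p => f (x p)) s) - queueVec q)
        (h := corrector P f lam m x) hη ((hlip _ _).trans hd) (hadd _ _) hd hnext (by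
          rw [add_sub_assoc, hc, inner_add_right]
          have h2 := hdrift q s hs
          have h3 : inner ℝ (perp (queueVec q)) (meanAfter P f m x - lam)
              ≤ ‖perp (queueVec q)‖ * η :=
            (real_inner_le_norm _ _).trans (mul_le_mul_of_nonneg_left (hm x) (norm_nonneg _))
          simp only [inner_sub_right] at h2 h3 hw ⊢
          linarith)
      simp only [driftConst]
      linarith
    · rw [← finMean_const (productChain P x) 0]
      exact finMean_mono _ fun x' => hVnn _
  rw [switchChain, pmfMean_bind]
  simp only [pmfMean_map]
  rw [← pmfMean_const (maxWeightService q) (ENNReal.ofReal (η * _)), ← pmfMean_add,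
    ← pmfMean_const (maxWeightService q) (ENNReal.ofReal (switchLyapunov _ _ _ _) + _)]
  refine ENNReal.tsum_le_tsum fun s => ?_
  by_cases hsm : s ∈ maxWeightSchedules q
  · exact mul_le_mul_right (hs s hsm) _
  · simp [maxWeightService, PMF.uniformOfFinset_apply, hsm]

/-! ### Uniform mixing and conclusion -/

theorem exists_mul_pow_le {a : ℝ} (ha0 : 0 ≤ a) (ha : a < 1) (A : ℝ) {η : ℝ} (hη : 0 < η) :
    ∃ m : ℕ, 1 ≤ m ∧ A * a ^ m ≤ η := by
  have h := (tendsto_pow_atTop_nhds_zero_of_lt_one ha0 ha).const_mul A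
  rw [mul_zero] at h
  obtain ⟨m, hm, hm1⟩ := ((h.eventually_le_const hη).and (Filter.eventually_ge_atTop 1)).exists
  exact ⟨m, hm1, hm⟩

theorem norm_meanAfter_sub_le_of_mixing {N : ℕ} {S : Type*} [Fintype S]
    {P : Fin N × Fin N → S → PMF S} {f : S → ℕ} {lam : MatSpace N} {α C : Fin N × Fin N → ℝ}
    {αmax Cmax : ℝ} (hα : ∀ p, 0 < α p ∧ α p ≤ αmax) (hC : ∀ p, 0 < C p ∧ C p ≤ Cmax)
    (hmix : ∀ p, HasMixingParameters (P p) f (lam p) (C p) (α p)) (hCmax : 0 ≤ Cmax)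
    (hαmax : 0 ≤ αmax) {m : ℕ} (hm : 1 ≤ m) (x : Fin N × Fin N → S) :
    ‖meanAfter P f m x - lam‖
      ≤ N * N * (2 * ((Finset.univ.sup f : ℕ) : ℝ) * Cmax) * αmax ^ m := by
  rw [mul_assoc]
  refine norm_le_card_mul _ (by positivity) fun p => ?_
  simp only [PiLp.sub_apply, meanAfter]
  refine (hmix p _ m hm).trans ?_
  have := (hα p).1.le
  have := (hC p).1.le
  gcongr
  · exact (hC p).2
  · exact (hα p).2

theorem finite_setOf_norm_queueVec_le (N : ℕ) (S : Type*) [Finite S] {η : ℝ} (hη : 0 < η)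
    (R : ℕ) : {z : SwitchState N S | ENNReal.ofReal (η * ‖queueVec z.1‖ ^ 2) ≤ R}.Finite := by
  obtain ⟨M, hM⟩ := exists_nat_ge ((R : ℝ) / η + 1)
  refine ((Set.finite_Icc (0 : Fin N × Fin N → ℕ) fun _ => M).prod
    (Set.finite_univ (α := Fin N × Fin N → S))).subset ?_
  rintro ⟨q, x⟩ hz
  simp only [Set.mem_ofPred_eq] at hz
  rw [← ENNReal.ofReal_natCast, ENNReal.ofReal_le_ofReal_iff (by positivity), mul_comm,
    ← le_div_iff₀ hη] at hz
  refine ⟨⟨fun p => Nat.zero_le _, fun p => ?_⟩, Set.mem_univ _⟩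
  have h1 : (q p : ℝ) ≤ ‖queueVec q‖ := by
    have := PiLp.norm_apply_le (queueVec q) p
    simpa [queueVec] using this
  have h2 : (q p : ℝ) ≤ M := by nlinarith [sq_nonneg (‖queueVec q‖ - 1), norm_nonneg (queueVec q)]
  exact_mod_cast h2

theorem inner_queueVec_nonpos_of_support {N : ℕ} (q : Fin N × Fin N → ℕ) (u : MatSpace N)
    (hqu : ∀ p, u p ≠ 0 → q p = 0) : inner ℝ (queueVec q) u ≤ 0 := by
  rw [inner_matSpace]
  refine (Finset.sum_eq_zero fun p _ => ?_).le
  by_cases hp : u p = 0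
  · simp [hp]
  · simp [queueVec, hqu p hp]

theorem mainTheorem2 (N : ℕ) (hN : 1 ≤ N) {Ω : Type*} [Fintype Ω]
    -- the arrivals to a queue are `f` of the state of its modulating chain
    (f : Ω → ℕ)
    -- transition laws of the modulating chains, for each `ε` and each queue `p = (i, j)`
    (P : ℝ → Fin N × Fin N → Ω → PMF Ω)
    (hirr : ∀ ε ∈ Set.Ioo (0 : ℝ) 1, IsIrreducibleChain (productChain (P ε)))
    (haper : ∀ ε ∈ Set.Ioo (0 : ℝ) 1, IsAperiodicChain (productChain (P ε)))
    -- `v` is on the saturated face, with positive entries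
    (v : MatSpace N) (hv : v ∈ saturatedFace N) (hvpos : 0 < ⨅ p, v p)
    -- the steady-state arrival rates are `(1 - ε) v`
    (πX : ℝ → PMF (Fin N × Fin N → Ω))
    (hstat : ∀ ε ∈ Set.Ioo (0 : ℝ) 1, IsSteadyState (productChain (P ε)) (πX ε))
    (hrate : ∀ ε ∈ Set.Ioo (0 : ℝ) 1, ∀ p,
      finMean (πX ε) (fun x => (f (x p) : ℝ)) = (1 - ε) * v p)
    -- the geometric mixing parameters are bounded uniformly in `ε`
    (α C : ℝ → Fin N × Fin N → ℝ) (αmax Cmax : ℝ) (hαmax : αmax < 1)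
    (hα : ∀ ε ∈ Set.Ioo (0 : ℝ) 1, ∀ p, 0 < α ε p ∧ α ε p ≤ αmax)
    (hC : ∀ ε ∈ Set.Ioo (0 : ℝ) 1, ∀ p, 0 < C ε p ∧ C ε p ≤ Cmax)
    (hmix : ∀ ε ∈ Set.Ioo (0 : ℝ) 1, ∀ p,
      HasMixingParameters (P ε p) f ((1 - ε) * v p) (C ε p) (α ε p)) :
    ∃ K : ℝ, ∀ ε ∈ Set.Ioo (0 : ℝ) 1, ε < (⨅ p, v p) / (2 * ‖v‖) →
      (∃ π : PMF (SwitchState N Ω), IsSteadyState (switchChain (P ε) f) π) ∧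
      ∀ π : PMF (SwitchState N Ω), IsSteadyState (switchChain (P ε) f) π →
        nonnegMean π (fun z => ‖perpTo (normalSpan N : Set (MatSpace N)) (queueVec z.1)‖ ^ 2)
            ≤ nonnegMean π (fun z => ‖perpTo (normalCone N) (queueVec z.1)‖ ^ 2) ∧
          nonnegMean π (fun z => ‖perpTo (normalCone N) (queueVec z.1)‖ ^ 2)
            ≤ ENNReal.ofReal K := by
  set b := ⨅ p, v p
  have hbv : ∀ p, b ≤ v p := fun p => ciInf_le (Set.finite_range _).bddBelow p
  have hv1 : ∀ p, v p ≤ 1 := fun p => by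
    rw [← hv.2.1 p.1]
    exact Finset.single_le_sum (f := fun j => v (p.1, j)) (fun j _ => hv.1 _) (Finset.mem_univ p.2)
  let p₀ : Fin N × Fin N := (⟨0, hN⟩, ⟨0, hN⟩)
  have hhalf : (1 / 2 : ℝ) ∈ Set.Ioo (0 : ℝ) 1 := by norm_num
  have hα0 : 0 ≤ αmax := (hα _ hhalf p₀).1.le.trans (hα _ hhalf p₀).2
  have hC0 : 0 ≤ Cmax := (hC _ hhalf p₀).1.le.trans (hC _ hhalf p₀).2
  obtain ⟨x₀, -⟩ := (πX (1 / 2)).support_nonempty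
  have hlam0 : ∀ ε ∈ Set.Ioo (0 : ℝ) 1, ∀ p, 0 ≤ ((1 - ε) • v) p := fun ε hε p =>
    mul_nonneg (sub_nonneg.2 hε.2.le) (hv.1 p)
  have hlam1 : ∀ ε ∈ Set.Ioo (0 : ℝ) 1, ∀ p, ((1 - ε) • v) p ≤ 1 := fun ε hε p =>
    mul_le_one₀ (by linarith [hε.1]) (hv.1 p) (hv1 p)
  have herr : ∀ ε ∈ Set.Ioo (0 : ℝ) 1, ∀ m : ℕ, 1 ≤ m → ∀ x,
      ‖meanAfter (P ε) f m x - (1 - ε) • v‖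
        ≤ N * N * (2 * ((Finset.univ.sup f : ℕ) : ℝ) * Cmax) * αmax ^ m := fun ε hε m hm x =>
    norm_meanAfter_sub_le_of_mixing (hα ε hε) (hC ε hε) (hmix ε hε) hC0 hα0 hm x
  obtain ⟨m, hm1, hm⟩ := exists_mul_pow_le hα0 hαmax
    (N * N * (2 * ((Finset.univ.sup f : ℕ) : ℝ) * Cmax)) (show 0 < b / 4 by positivity)
  refine ⟨driftConst (slotBound N f) (m * slotBound N f) (b / 4) / (b / 4),
    fun ε hε hεv => ⟨?_, fun π hπ => ⟨?_, ?_⟩⟩⟩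
  · -- the drift of the whole vector of queue lengths, with a rate proportional to `ε`
    -- so the truncation level of the corrector depends on `ε` here
    have hη : 0 < ε * b / 2 := by have := hε.1; positivity
    obtain ⟨n, hn1, hn⟩ := exists_mul_pow_le hα0 hαmax
      (N * N * (2 * ((Finset.univ.sup f : ℕ) : ℝ) * Cmax)) hη
    refine exists_isSteadyState_of_drift _ (0, x₀) ENNReal.ofReal_ne_top ENNReal.ofReal_ne_top
      (switch_drift (P ε) f (hlam0 ε hε) (hlam1 ε hε) (perp := id) (fun x y => le_rfl)
        (fun x y => by simp) (fun q u _ hqu => inner_queueVec_nonpos_of_support q u hqu) hη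
        (fun q s hs => ?_) fun x => (herr ε hε n hn1 x).trans hn)
      (finite_setOf_norm_queueVec_le N Ω hη)
    have := inner_queueVec_drift hs hv hvpos hbv hε.1.le
    simp only [id]
    linarith
  · exact ENNReal.tsum_le_tsum fun z => mul_le_mul_right (ENNReal.ofReal_le_ofReal
      (pow_le_pow_left₀ (norm_nonneg _) (norm_perpTo_normalSpan_le _) 2)) _
  · -- half of `b` is lost to `ε`, and half of the rest to the mixing error
    have hη : 0 < b / 4 := by positivity
    have hεb : ε * ‖v‖ ≤ b / 2 := by
      have hvn : 0 < ‖v‖ := norm_pos_iff.2 fun h => by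
        have := hvpos.trans_le (hbv p₀)
        simp [h] at this
      rw [lt_div_iff₀ (by positivity)] at hεv
      linarith
    have hmean := hπ.pmfMean_le_of_drift (fun z => ENNReal.ofReal_ne_top)
      (switch_drift (P ε) f (hlam0 ε hε) (hlam1 ε hε) norm_conePerp_sub_le norm_conePerp_le_add
        inner_conePerp_nonpos_of_support hη (fun q s hs => by
          have := inner_conePerp_drift hs hv hvpos hbv hε.1.le hεb
          linarith) fun x => (herr ε hε m hm1 x).trans hm)
    rw [ENNReal.ofReal_div_of_pos hη, ENNReal.le_div_iff_mul_le
      (Or.inl (by simpa using hη)) (Or.inl ENNReal.ofReal_ne_top), mul_comm]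
    refine le_trans (le_of_eq ?_) hmean
    simp only [nonnegMean, pmfMean, ← ENNReal.tsum_mul_left]
    refine tsum_congr fun z => ?_
    rw [ENNReal.ofReal_mul hη.le]
    simp only [conePerp]
    ring
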